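/- **The ASE Crash Theorem.** Base stations (BSs), all of them active, form a homogeneous Poisson point process of density $\lambda>0$ in the plane. A typical user is at the origin, and $L\ge 0$ is the antenna height difference, so that the link to a BS at 2D distance $r$ has length $w=\sqrt{r^2+L^2}\ge L$. *Path loss.* Let $N\ge 1$, let $d_1<\dots<d_{N-1}$ be breakpoints, and say that $w$ lies in piece $1$ if $w\le d_1$, in piece $n$ if $d_{n-1}<w\le d_n$ $(1<n<N)$, and in piece $N$ if $w>d_{N-1}$. For $w$ in piece $n$ let $\zeta^{\rm L}(w)=A_n^{\rm L}w^{-\alpha_n^{\rm L}}$ and $\zeta^{\rm NL}(w)=A_n^{\rm NL}w^{-\alpha_n^{\rm NL}}$, with $A_n^{\rm L},A_n^{\rm NL},\alpha_n^{\rm L},\alpha_n^{\rm NL}>0$ such that $\zeta^{\rm L}$ and $\zeta^{\rm NL}$ are continuous and decreasing on $[L,\infty)$, and let $\Pr^{\rm L}(w)=\Pr_n^{\rm L}(w)\in[0,1]$, where each $\Pr_n^{\rm L}$ is non-increasing on the part of piece $n$ in $[L,\infty)$. Given the BS positions, the links are independent; a link of length $w$ is line-of-sight with probability $\Pr^{\rm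 L}(w)$ and then has path loss $\zeta=\zeta^{\rm L}(w)$, and otherwise it has path loss $\zeta=\zeta^{\rm NL}(w)$. *SINR.* The channel gains of the links are i.i.d. exponential with mean $1$ (Rayleigh fading), independent of the positions and of the line-of-sight states. The user is served by the BS $b_o$ with the largest value of $\zeta$. With transmission power $P>0$ and noise power $P_{\rm N}>0$, $$\mathrm{SINR}=\frac{P\,\zeta_{b_o}\,h_{b_o}}{\sum_{b\ne b_o}P\,\zeta_b\,h_b+P_{\rm N}},$$ where $\zeta_b$ and $h_b$ are the path loss and the channel gain of the BS $b$ (and $\mathrm{SINR}=0$ if the sum is infinite). Define $$p^{\rm cov}(\lambda,\gamma)=\Pr[\mathrm{SINR}>\gamma],\qquad f_\Gamma(\lambda,\gamma)=\frac{\partial(1-p^{\rm cov}(\lambda,\gamma))}{\partial\gamma},\qquad A^{\rm ASE}(\lambda,\gamma_0)=\lambda\int_{\gamma_0}^{\infty}\log_2(1+\gamma)\,f_\Gamma(\lambda,\gamma)\,d\gamma .$$ *Claim.* If $L>0$ and $0<\gamma,\gamma_0<\infty$, then $$\lim_{\lambda\to\infty}p^{\rm cov}(\lambda,\gamma)=0\qquad\text{and}\qquad\lim_{\lambda\to\infty}A^{\rm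 ASE}(\lambda,\gamma_0)=0 .$$ Here, for every $\lambda>0$, the function $p^{\rm cov}(\lambda,\cdot)$ is differentiable on $(0,\infty)$ and the integral that defines $A^{\rm ASE}(\lambda,\gamma_0)$ converges absolutely. -/

import Mathlib

open MeasureTheory ProbabilityTheory Filter Topology

noncomputable section

/-- The plane in which the base stations are deployed. The typical user sits at the origin. -/
abbrev Plane := EuclideanSpace ℝ (Fin 2)

/-! ### The homogeneous Poisson point process -/

/-- The number of points of the configuration `b` (points listed as `b 0, b 1, …`) in `A`. -/
def pointCount (b : ℕ → Plane) (A : Set Plane) : ℕ∞ := {i | b i ∈ A}.encard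

/-- `ν` is the law of an enumeration of the points of a homogeneous Poisson point process of
density `lam > 0` in the plane: the number of points in a bounded Borel set `A` is Poisson
distributed with mean `lam * area A`, and the numbers of points in disjoint bounded Borel sets are
independent. (Such a process has infinitely many points almost surely, so its points can be
listed along `ℕ`; nothing is assumed on the order in which they are listed.) -/
structure IsHPPP (lam : ℝ) (ν : Measure (ℕ → Plane)) : Prop where
  isProbabilityMeasure : IsProbabilityMeasure ν
  count_poisson : ∀ A : Set Plane, MeasurableSet A → Bornology.IsBounded A → ∀ k : ℕ,
    ν {b | pointCount b A = k} =
      ENNReal.ofReal (Real.exp (-(lam * volume.real A)) * (lam * volume.real A) ^ k / k.factorial)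
  count_indep : ∀ (m : ℕ) (A : Fin m → Set Plane), (∀ j, MeasurableSet (A j)) →
    (∀ j, Bornology.IsBounded (A j)) → (∀ j j', j ≠ j' → Disjoint (A j) (A j')) →
    iIndepFun (fun j (b : ℕ → Plane) => pointCount b (A j)) ν

/-! ### Piecewise LoS / NLoS path loss -/

/-- The index of the piece to which the distance `w` belongs, for breakpoints
`d 0 < d 1 < … < d (M - 1)`. The pieces are numbered from `0`: it is `0` for `w ≤ d 0`, it is `n`
for `d (n - 1) < w ≤ d n`, and it is `M` for `w > d (M - 1)`. -/
def pieceIndex {M : ℕ} (d : Fin M → ℝ) (w : ℝ) : Fin (M + 1) :=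
  ⟨(Finset.univ.filter fun k => d k < w).card,
    Nat.lt_succ_of_le ((Finset.card_le_univ _).trans_eq (Fintype.card_fin M))⟩

/-- The piecewise power-law path loss function `w ↦ A_n * w ^ (-α_n)` on the `n`-th piece. -/
def piecewisePathLoss {M : ℕ} (d : Fin M → ℝ) (A α : Fin (M + 1) → ℝ) (w : ℝ) : ℝ :=
  A (pieceIndex d w) * w ^ (-α (pieceIndex d w))

/-- The parameters of the downlink network, except for the density of base stations. There are
`M + 1` pieces in the path loss model. -/
structure NetworkModel where
  /-- the absolute antenna height difference between base stations and users -/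
  L : ℝ
  L_nonneg : 0 ≤ L
  /-- the number of breakpoints -/
  M : ℕ
  /-- the breakpoints -/
  d : Fin M → ℝ
  d_strictMono : StrictMono d
  /-- LoS path losses at reference distance `1` -/
  AL : Fin (M + 1) → ℝ
  /-- NLoS path losses at reference distance `1` -/
  ANL : Fin (M + 1) → ℝ
  AL_pos : ∀ n, 0 < AL n
  ANL_pos : ∀ n, 0 < ANL n
  /-- LoS path loss exponents -/
  αL : Fin (M + 1) → ℝ
  /-- NLoS path loss exponents -/
  αNL : Fin (M + 1) → ℝ
  αL_pos : ∀ n, 0 < αL n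
  αNL_pos : ∀ n, 0 < αNL n
  continuousOn_LoS : ContinuousOn (piecewisePathLoss d AL αL) (Set.Ici L)
  continuousOn_NLoS : ContinuousOn (piecewisePathLoss d ANL αNL) (Set.Ici L)
  antitoneOn_LoS : AntitoneOn (piecewisePathLoss d AL αL) (Set.Ici L)
  antitoneOn_NLoS : AntitoneOn (piecewisePathLoss d ANL αNL) (Set.Ici L)
  /-- the pieces of the LoS probability function -/
  prLoS : Fin (M + 1) → ℝ → ℝ
  prLoS_mem : ∀ w, L ≤ w → prLoS (pieceIndex d w) w ∈ Set.Icc (0 : ℝ) 1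
  prLoS_antitoneOn : ∀ n, AntitoneOn (prLoS n) {w | L ≤ w ∧ pieceIndex d w = n}
  /-- the transmission power of each base station -/
  P : ℝ
  P_pos : 0 < P
  /-- the noise power at each user -/
  PN : ℝ
  PN_pos : 0 < PN

namespace NetworkModel

variable (S : NetworkModel)

/-- The LoS path loss function. -/
def lossLoS (w : ℝ) : ℝ := piecewisePathLoss S.d S.AL S.αL w

/-- The NLoS path loss function. -/
def lossNLoS (w : ℝ) : ℝ := piecewisePathLoss S.d S.ANL S.αNL w

/-- The LoS probability function. -/
def probLoS (w : ℝ) : ℝ := S.prLoS (pieceIndex S.d w) w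

/-- The 3D distance between the typical user and a base station at `x`. -/
def dist3D (x : Plane) : ℝ := Real.sqrt (‖x‖ ^ 2 + S.L ^ 2)

/-! ### The random network

A realization consists of the positions `b i` of the base stations, of marks `u i` that decide
whether the link to the `i`-th base station is LoS, and of the channel gains `g i`. -/

/-- A realization of the network. -/
abbrev Realization := (ℕ → Plane) × (ℕ → unitInterval) × (ℕ → ℝ)

/-- The law of the network when the positions have law `ν`: the marks are i.i.d. uniform on
`[0, 1]`, the channel gains are i.i.d. exponential with mean one (Rayleigh fading), and positions,
marks and gains are independent. -/
def networkLaw (ν : Measure (ℕ → Plane)) : Measure Realization :=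
  ν.prod ((Measure.infinitePi fun _ : ℕ => (volume : Measure unitInterval)).prod
    (Measure.infinitePi fun _ : ℕ => expMeasure 1))

/-- The path loss from the `i`-th base station to the typical user. The link is LoS when
`u i < probLoS w`; given the positions this happens with probability `probLoS w`, independently
for different base stations. -/
def loss (ω : Realization) (i : ℕ) : ℝ :=
  if (ω.2.1 i : ℝ) < S.probLoS (S.dist3D (ω.1 i)) then S.lossLoS (S.dist3D (ω.1 i))
  else S.lossNLoS (S.dist3D (ω.1 i))

/-- The index of the base station that serves the typical user, i.e. of the one with the largest
`loss` value (the least such index; almost surely exactly one index attains the maximum). -/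
def servingIndex (ω : Realization) : ℕ := sInf {i | ∀ j, S.loss ω j ≤ S.loss ω i}

/-- The aggregate interference of all base stations but the serving one (possibly infinite). -/
def interference (ω : Realization) : ENNReal :=
  ∑' i : {i : ℕ // i ≠ S.servingIndex ω}, ENNReal.ofReal (S.P * S.loss ω i * ω.2.2 i)

/-- The signal-to-interference-plus-noise ratio of the typical user. The quotient is taken in
`[0, ∞]`, so that it is `0` when the interference is infinite; it is finite since `PN > 0`. -/
def SINR (ω : Realization) : ℝ :=
  (ENNReal.ofReal (S.P * S.loss ω (S.servingIndex ω) * ω.2.2 (S.servingIndex ω)) /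
    (S.interference ω + ENNReal.ofReal S.PN)).toReal

/-- The coverage probability, i.e. the probability that the SINR exceeds `γ`. -/
def coverageProb (ν : Measure (ℕ → Plane)) (γ : ℝ) : ℝ :=
  (networkLaw ν).real {ω | γ < S.SINR ω}

/-- The density of the SINR, i.e. the derivative of its distribution function. -/
def sinrDensity (ν : Measure (ℕ → Plane)) (γ : ℝ) : ℝ :=
  deriv (fun x => 1 - S.coverageProb ν x) γ

/-- The area spectral efficiency for density `lam` and minimum working SINR `γ₀`. -/
def ASE (lam : ℝ) (ν : Measure (ℕ → Plane)) (γ₀ : ℝ) : ℝ :=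
  lam * ∫ γ in Set.Ioi γ₀, Real.logb 2 (1 + γ) * S.sinrDensity ν γ

end NetworkModel

end

/-! ### The exponential kernel on `[0, ∞]` and the tail of exponential gains -/

/-! The serving base station depends only on the positions and the line-of-sight marks, not on the
gains. Its gain is exponential and independent of the other gains, so conditioning on everything
else turns `SINR > x` into an exponential tail. The coverage probability is therefore E[exp(-xY)],
where Y is `load` and exp(-x∞) = 0 (`networkLaw_lt_SINR`).

Since L > 0, all path losses are at most `maxLoss`, while stations in the unit disc have path loss
at least `nearLoss`. Each non-serving station in the disc thus adds at least c·h to Y, with h its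
gain and c = `nearLoss` / `maxLoss`, whichever station serves. With k stations in the disc the
conditional coverage is at most q^(k-1), where q < 1 bounds the Laplace transform of c·h
(`lintegral_gain_le`). Averaging over the Poisson count gives C·exp(-κλ), which outweighs the factor
λ in the area spectral efficiency (`exists_coverageProb_le`).

The SINR density is E[Y exp(-xY); Y < ∞]. Noise keeps Y above c₀ = `PN` / (`P` * `maxLoss`) > 0, so
for x ≥ γ the density is at most a constant times exp(-c₀x/4) times the coverage at γ/4
(`sinrDensity_le`). The first factor makes the logarithm integrable; the second carries the decay in
λ. -/

/-- The function `t ↦ exp (-s t)` on `[0, ∞]`, with value `0` at `∞`. -/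
noncomputable def expKernel (s : ℝ) (t : ENNReal) : ENNReal :=
  if t = ⊤ then 0 else ENNReal.ofReal (Real.exp (-(s * t.toReal)))

@[simp] lemma expKernel_top (s : ℝ) : expKernel s ⊤ = 0 := by simp [expKernel]

lemma expKernel_of_ne_top (s : ℝ) {t : ENNReal} (ht : t ≠ ⊤) :
    expKernel s t = ENNReal.ofReal (Real.exp (-(s * t.toReal))) := by simp [expKernel, ht]

@[fun_prop] lemma measurable_expKernel (s : ℝ) : Measurable (expKernel s) := by
  unfold expKernel
  refine Measurable.ite (measurableSet_singleton _) measurable_const ?_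
  fun_prop

lemma expKernel_anti {s : ℝ} (hs : 0 ≤ s) : Antitone (expKernel s) := by
  intro t t' h
  rcases eq_or_ne t' ⊤ with rfl | h'
  · simp
  · have ht : t ≠ ⊤ := ne_top_of_le_ne_top h' h
    rw [expKernel_of_ne_top s ht, expKernel_of_ne_top s h']
    have := ENNReal.toReal_mono h' h
    gcongr

lemma expKernel_add (s : ℝ) (t t' : ENNReal) :
    expKernel s (t + t') = expKernel s t * expKernel s t' := by
  rcases eq_or_ne t ⊤ with rfl | h
  · simp
  rcases eq_or_ne t' ⊤ with rfl | h'
  · simp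
  rw [expKernel_of_ne_top s h, expKernel_of_ne_top s h', expKernel_of_ne_top s (by simp [h, h']),
    ← ENNReal.ofReal_mul (Real.exp_nonneg _), ← Real.exp_add, ENNReal.toReal_add h h']
  ring_nf

lemma expKernel_zero_right (s : ℝ) : expKernel s 0 = 1 := by simp [expKernel]

lemma expKernel_sum {ι : Type*} (s : ℝ) (F : Finset ι) (t : ι → ENNReal) :
    expKernel s (∑ i ∈ F, t i) = ∏ i ∈ F, expKernel s (t i) := by
  classical
  induction F using Finset.induction_on with
  | empty => simp [expKernel_zero_right]
  | insert a F ha ih => rw [Finset.sum_insert ha, Finset.prod_insert ha, expKernel_add, ih]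

lemma expKernel_le_one {s : ℝ} (hs : 0 ≤ s) (t : ENNReal) : expKernel s t ≤ 1 := by
  rw [← expKernel_zero_right s]
  exact expKernel_anti hs zero_le

lemma expMeasure_Ioi {c : ℝ} (hc : 0 ≤ c) :
    expMeasure 1 (Set.Ioi c) = ENNReal.ofReal (Real.exp (-c)) := by
  have := isProbabilityMeasure_expMeasure one_pos
  rw [← Set.compl_Iic, prob_compl_eq_one_sub measurableSet_Iic, ← ofReal_cdf,
    cdf_expMeasure_eq one_pos, if_pos hc, ← ENNReal.ofReal_one,
    ← ENNReal.ofReal_sub _ (by simpa using hc)]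
  simp

lemma expMeasure_lt_ofReal {x : ℝ} (hx : 0 < x) (t : ENNReal) :
    expMeasure 1 {h | ENNReal.ofReal x * t < ENNReal.ofReal h} = expKernel x t := by
  rcases eq_or_ne t ⊤ with rfl | ht
  · simp [ENNReal.mul_top, hx]
  · rw [expKernel_of_ne_top x ht, ← expMeasure_Ioi (by positivity)]
    congr 1
    ext h
    rw [Set.mem_ofPred_eq, Set.mem_Ioi, ← ENNReal.ofReal_toReal ht, ← ENNReal.ofReal_mul hx.le,
      ENNReal.ofReal_lt_ofReal_iff', ENNReal.toReal_ofReal (by positivity)]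
    constructor
    · exact fun h => h.1
    · exact fun h => ⟨h, lt_of_le_of_lt (by positivity) h⟩

/-! ### One coordinate of an infinite product against the others -/

lemma indepFun_eval_restrict {Ω : ℕ → Type*} [∀ i, MeasurableSpace (Ω i)]
    (μ : ∀ i, Measure (Ω i)) [∀ i, IsProbabilityMeasure (μ i)] (o : ℕ) :
    IndepFun (fun g : ∀ i, Ω i => g o) (fun (g : ∀ i, Ω i) (i : {i : ℕ // i ≠ o}) => g i)
      (Measure.infinitePi μ) := by
  have h : iIndepFun (fun i (g : ∀ i, Ω i) => g i) (Measure.infinitePi μ) :=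
    iIndepFun_infinitePi (X := fun i (x : Ω i) => x) (fun i => measurable_id)
  have h2 := indep_iSup_of_disjoint (S := {o}) (T := {i | i ≠ o})
    (fun i => (measurable_pi_apply i).comap_le) h (by simp)
  refine indep_of_indep_of_le_left (indep_of_indep_of_le_right h2 ?_) ?_
  · rw [← measurable_iff_comap_le]
    refine @measurable_pi_lambda _ _ _ (_) _ _ fun i => ?_
    rw [measurable_iff_comap_le]
    exact le_iSup₂ (f := fun (j : ℕ) (_ : j ∈ {i | i ≠ o}) =>
      MeasurableSpace.comap (fun g : ∀ i, Ω i => g j) inferInstance) i.1 i.2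
  · simp

/-- Condition on all gains but the `o`-th: these determine `T`, and the `o`-th is independent of
them, so Fubini leaves a one-dimensional exponential tail. -/
lemma infinitePi_exp_lt {x : ℝ} (hx : 0 < x) (o : ℕ) {T : ({i : ℕ // i ≠ o} → ℝ) → ENNReal}
    (hT : Measurable T) :
    Measure.infinitePi (fun _ : ℕ => expMeasure 1)
        {g | ENNReal.ofReal x * T (fun i => g i) < ENNReal.ofReal (g o)} =
      ∫⁻ g, expKernel x (T fun i => g i) ∂Measure.infinitePi (fun _ : ℕ => expMeasure 1) := by
  have := isProbabilityMeasure_expMeasure one_pos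
  set G := Measure.infinitePi (fun _ : ℕ => expMeasure 1) with hG
  have hr : Measurable fun (g : ℕ → ℝ) (i : {i : ℕ // i ≠ o}) => g i := by fun_prop
  have hmT : Measurable fun g : ℕ → ℝ => T fun i => g i := hT.comp hr
  have hind : IndepFun (fun g : ℕ → ℝ => T fun i => g i) (fun g : ℕ → ℝ => g o) G :=
    (indepFun_eval_restrict (fun _ : ℕ => expMeasure 1) o).symm.comp hT measurable_id
  have hmap := (indepFun_iff_map_prod_eq_prod_map_map hmT.aemeasurable
    (measurable_pi_apply o).aemeasurable).1 hind
  have hset : MeasurableSet {p : ENNReal × ℝ | ENNReal.ofReal x * p.1 < ENNReal.ofReal p.2} :=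
    measurableSet_lt (by fun_prop) (by fun_prop)
  have h1 : G {g | ENNReal.ofReal x * T (fun i => g i) < ENNReal.ofReal (g o)} =
      G.map (fun g => (T fun i => g i, g o))
        {p : ENNReal × ℝ | ENNReal.ofReal x * p.1 < ENNReal.ofReal p.2} := by
    rw [Measure.map_apply (hmT.prodMk (measurable_pi_apply o)) hset]
    rfl
  have hev : G.map (fun g => g o) = expMeasure 1 := Measure.infinitePi_map_eval _ o
  rw [h1, hmap, hev, Measure.prod_apply hset, lintegral_map (measurable_measure_prodMk_left hset) hmT]
  exact lintegral_congr fun g => expMeasure_lt_ofReal hx _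

/-! ### The probability generating function of a product of kernels -/

/-- The kernel is strictly below 1 wherever `h > 0`, a set of full measure. This strict inequality
is the source of the exponential decay in the density. -/
lemma lintegral_expKernel_lt_one {s : ℝ} (hs : 0 < s) {c : ENNReal} (hc : c ≠ 0) :
    ∫⁻ h, expKernel s (c * ENNReal.ofReal h) ∂expMeasure 1 < 1 := by
  have := isProbabilityMeasure_expMeasure one_pos
  have hpos : expMeasure 1 (Set.Ioi 0) = 1 := by simp [expMeasure_Ioi]
  have hae : ∀ᵐ h ∂expMeasure 1, h ∈ Set.Ioi (0 : ℝ) :=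
    (prob_compl_eq_zero_iff measurableSet_Ioi).2 hpos
  have hm : Measurable fun h => expKernel s (c * ENNReal.ofReal h) := by fun_prop
  have hle : ∫⁻ h, expKernel s (c * ENNReal.ofReal h) ∂expMeasure 1 ≤ ∫⁻ _, 1 ∂expMeasure 1 :=
    lintegral_mono fun h => expKernel_le_one hs.le _
  have hlt : ∫⁻ h, expKernel s (c * ENNReal.ofReal h) ∂expMeasure 1 < ∫⁻ _, 1 ∂expMeasure 1 := by
    refine lintegral_strict_mono (IsProbabilityMeasure.ne_zero _) aemeasurable_const
      (ne_top_of_le_ne_top (by simp) hle) ?_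
    filter_upwards [hae] with h (hh : 0 < h)
    rcases eq_or_ne (c * ENNReal.ofReal h) ⊤ with ht | ht
    · simp [ht]
    · rw [expKernel_of_ne_top s ht, ENNReal.ofReal_lt_one, Real.exp_lt_one_iff]
      have : 0 < (c * ENNReal.ofReal h).toReal :=
        ENNReal.toReal_pos (mul_ne_zero hc (by simpa using hh)) ht
      nlinarith
  simpa using hlt

lemma lintegral_expKernel_sum (s : ℝ) (c : ENNReal) (F : Finset ℕ) :
    ∫⁻ g, expKernel s (∑ i ∈ F, c * ENNReal.ofReal (g i))
        ∂Measure.infinitePi (fun _ : ℕ => expMeasure 1) =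
      (∫⁻ h, expKernel s (c * ENNReal.ofReal h) ∂expMeasure 1) ^ F.card := by
  have := isProbabilityMeasure_expMeasure one_pos
  have hm : Measurable fun h => expKernel s (c * ENNReal.ofReal h) := by fun_prop
  simp_rw [expKernel_sum]
  rw [lintegral_prod_eq_prod_lintegral_of_indepFun F
    (fun i (g : ℕ → ℝ) => expKernel s (c * ENNReal.ofReal (g i)))
    (iIndepFun_infinitePi (X := fun _ => fun h => expKernel s (c * ENNReal.ofReal h))
      (fun _ => hm)) (fun i => hm.comp (measurable_pi_apply i)), Finset.prod_eq_pow_card]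
  intro i _
  rw [← Measure.infinitePi_map_eval (fun _ : ℕ => expMeasure 1) i,
    lintegral_map hm (measurable_pi_apply i)]
  simp_rw [Measure.infinitePi_map_eval]

/-! ### Measurability of the network -/

lemma measurable_pieceIndex {M : ℕ} (d : Fin M → ℝ) : Measurable (pieceIndex d) := by
  have hval : Measurable fun w => (pieceIndex d w : ℕ) := by
    have : (fun w => (pieceIndex d w : ℕ)) = fun w => ∑ k, if d k < w then 1 else 0 := by
      ext w
      simp [pieceIndex]
    rw [this]
    exact Finset.measurable_sum _ fun k _ =>
      Measurable.ite measurableSet_Ioi measurable_const measurable_const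
  refine measurable_to_countable' fun n => ?_
  have : pieceIndex d ⁻¹' {n} = (fun w => (pieceIndex d w : ℕ)) ⁻¹' {(n : ℕ)} := by
    ext w
    simp [Fin.ext_iff]
  rw [this]
  exact hval (measurableSet_singleton _)

lemma measurable_piecewisePathLoss {M : ℕ} (d : Fin M → ℝ) (A α : Fin (M + 1) → ℝ) :
    Measurable (piecewisePathLoss d A α) := by
  have h := measurable_pieceIndex d
  have hA : Measurable A := measurable_from_top
  have hα : Measurable α := measurable_from_top
  unfold piecewisePathLoss
  fun_prop

namespace NetworkModel

variable (S : NetworkModel)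

lemma le_dist3D (x : Plane) : S.L ≤ S.dist3D x :=
  Real.le_sqrt_of_sq_le (by nlinarith [sq_nonneg ‖x‖])

lemma measurable_dist3D : Measurable S.dist3D := by
  unfold dist3D
  fun_prop

/-- No measurability of `prLoS` is assumed. On its piece it is monotone and bounded, so it extends
to an antitone function on ℝ, and such functions are Borel. -/
lemma measurable_probLoS_dist3D : Measurable fun x => S.probLoS (S.dist3D x) := by
  have h : ∀ n, ∃ g : ℝ → ℝ, Antitone g ∧
      Set.EqOn (S.prLoS n) g {w | S.L ≤ w ∧ pieceIndex S.d w = n} := fun n =>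
    (S.prLoS_antitoneOn n).exists_antitone_extension
      ⟨0, by rintro _ ⟨w, ⟨hw, rfl⟩, rfl⟩; exact (S.prLoS_mem w hw).1⟩
      ⟨1, by rintro _ ⟨w, ⟨hw, rfl⟩, rfl⟩; exact (S.prLoS_mem w hw).2⟩
  choose g hg heq using h
  have hm : Measurable fun p : Fin (S.M + 1) × ℝ => g p.1 p.2 :=
    measurable_from_prod_countable_right fun n => (hg n).measurable
  have : (fun x => S.probLoS (S.dist3D x)) =
      fun x => g (pieceIndex S.d (S.dist3D x)) (S.dist3D x) := by
    ext x
    exact heq _ ⟨S.le_dist3D x, rfl⟩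
  rw [this]
  exact hm.comp (((measurable_pieceIndex S.d).comp S.measurable_dist3D).prodMk S.measurable_dist3D)

lemma measurable_loss (i : ℕ) : Measurable fun ω => S.loss ω i := by
  have hb : Measurable fun ω : Realization => ω.1 i := by fun_prop
  have hu : Measurable fun ω : Realization => (ω.2.1 i : ℝ) := by fun_prop
  refine Measurable.ite (measurableSet_lt hu (S.measurable_probLoS_dist3D.comp hb)) ?_ ?_
  · exact (measurable_piecewisePathLoss _ _ _).comp (S.measurable_dist3D.comp hb)
  · exact (measurable_piecewisePathLoss _ _ _).comp (S.measurable_dist3D.comp hb)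

lemma measurable_servingIndex : Measurable S.servingIndex := by
  classical
  have hA : ∀ i, MeasurableSet {ω | ∀ j, S.loss ω j ≤ S.loss ω i} := fun i => by
    rw [Set.ofPred_forall]
    exact MeasurableSet.iInter fun j => measurableSet_le (S.measurable_loss j) (S.measurable_loss i)
  have hE : MeasurableSet {ω | ∃ i, ∀ j, S.loss ω j ≤ S.loss ω i} := by
    rw [Set.ofPred_exists]
    exact MeasurableSet.iUnion hA
  -- When no maximum is attained, `sInf ∅ = 0`; the second disjunct makes `Nat.find` return 0 there
  -- too.
  have hp : ∀ ω, ∃ i, (∀ j, S.loss ω j ≤ S.loss ω i) ∨ ¬ ∃ i, ∀ j, S.loss ω j ≤ S.loss ω i := by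
    intro ω
    by_cases h : ∃ i, ∀ j, S.loss ω j ≤ S.loss ω i
    · exact h.imp fun i hi => Or.inl hi
    · exact ⟨0, Or.inr h⟩
  have : S.servingIndex = fun ω => Nat.find (hp ω) := by
    ext ω
    by_cases h : ∃ i, ∀ j, S.loss ω j ≤ S.loss ω i
    · have hne : {i | ∀ j, S.loss ω j ≤ S.loss ω i}.Nonempty := h
      rw [servingIndex, Nat.sInf_def hne]
      exact Nat.find_congr' (by simp [h])
    · have h0 : Nat.find (hp ω) = 0 := (Nat.find_eq_zero _).2 (Or.inr h)
      rw [h0, servingIndex, Nat.sInf_eq_zero]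
      exact Or.inr (Set.eq_empty_of_forall_notMem fun i hi => h ⟨i, hi⟩)
  rw [this]
  exact measurable_find hp fun i => (hA i).union hE.compl

lemma measurable_loss_servingIndex : Measurable fun ω => S.loss ω (S.servingIndex ω) := by
  have h : Measurable fun p : ℕ × Realization => S.loss p.2 p.1 :=
    measurable_from_prod_countable_right S.measurable_loss
  exact h.comp (S.measurable_servingIndex.prodMk measurable_id)

lemma interference_eq_tsum (ω : Realization) : S.interference ω = ∑' i : ℕ,
    if i ≠ S.servingIndex ω then ENNReal.ofReal (S.P * S.loss ω i * ω.2.2 i) else 0 :=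
  (tsum_subtype {i | i ≠ S.servingIndex ω}
    fun i => ENNReal.ofReal (S.P * S.loss ω i * ω.2.2 i)).trans
      (tsum_congr fun i => by simp [Set.indicator_apply])

lemma measurable_interference : Measurable S.interference := by
  rw [funext S.interference_eq_tsum]
  refine Measurable.tsum fun i => ?_
  have := S.measurable_loss i
  refine Measurable.ite ?_ (by fun_prop) measurable_const
  exact (measurableSet_eq_fun measurable_const S.measurable_servingIndex).compl

/-- The interference plus noise relative to the mean power received from the serving base
station. -/
noncomputable def load (ω : Realization) : ENNReal :=
  (S.interference ω + ENNReal.ofReal S.PN) / ENNReal.ofReal (S.P * S.loss ω (S.servingIndex ω))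

lemma measurable_load : Measurable S.load := by
  have h1 := S.measurable_interference
  have h2 := S.measurable_loss_servingIndex
  unfold load
  fun_prop

lemma measurable_expKernel_load (s : ℝ) : Measurable fun ω => expKernel s (S.load ω) :=
  (measurable_expKernel s).comp S.measurable_load

/-! ### Bounds on the path loss -/

lemma piecewisePathLoss_pos {M : ℕ} (d : Fin M → ℝ) {A : Fin (M + 1) → ℝ} (α : Fin (M + 1) → ℝ)
    (hA : ∀ n, 0 < A n) {w : ℝ} (hw : 0 < w) : 0 < piecewisePathLoss d A α w :=
  mul_pos (hA _) (Real.rpow_pos_of_pos hw _)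

lemma lossLoS_pos {w : ℝ} (hw : 0 < w) : 0 < S.lossLoS w := piecewisePathLoss_pos _ _ S.AL_pos hw

lemma lossNLoS_pos {w : ℝ} (hw : 0 < w) : 0 < S.lossNLoS w :=
  piecewisePathLoss_pos _ _ S.ANL_pos hw

/-- The largest possible path loss value. -/
noncomputable def maxLoss : ℝ := max (S.lossLoS S.L) (S.lossNLoS S.L)

/-- A lower bound on the path loss values of base stations at 2D distance at most one. -/
noncomputable def nearLoss : ℝ :=
  min (S.lossLoS (Real.sqrt (1 + S.L ^ 2))) (S.lossNLoS (Real.sqrt (1 + S.L ^ 2)))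

variable {S}

lemma maxLoss_pos (hL : 0 < S.L) : 0 < S.maxLoss := lt_max_of_lt_left (S.lossLoS_pos hL)

lemma nearLoss_pos : 0 < S.nearLoss :=
  lt_min (S.lossLoS_pos (by positivity)) (S.lossNLoS_pos (by positivity))

lemma loss_pos (hL : 0 < S.L) (ω : Realization) (i : ℕ) : 0 < S.loss ω i := by
  have := hL.trans_le (S.le_dist3D (ω.1 i))
  unfold loss
  split_ifs
  exacts [S.lossLoS_pos this, S.lossNLoS_pos this]

lemma loss_le_maxLoss (ω : Realization) (i : ℕ) : S.loss ω i ≤ S.maxLoss := by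
  have h := S.le_dist3D (ω.1 i)
  unfold loss
  split_ifs
  · exact (S.antitoneOn_LoS Set.self_mem_Ici h h).trans (le_max_left _ _)
  · exact (S.antitoneOn_NLoS Set.self_mem_Ici h h).trans (le_max_right _ _)

lemma nearLoss_le_loss {ω : Realization} {i : ℕ} (hi : ω.1 i ∈ Metric.closedBall (0 : Plane) 1) :
    S.nearLoss ≤ S.loss ω i := by
  have h := S.le_dist3D (ω.1 i)
  have h1 : ‖ω.1 i‖ ≤ 1 := by simpa using hi
  have h2 : S.dist3D (ω.1 i) ≤ Real.sqrt (1 + S.L ^ 2) :=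
    Real.sqrt_le_sqrt (by nlinarith [norm_nonneg (ω.1 i)])
  unfold loss
  split_ifs
  · exact (min_le_left _ _).trans (S.antitoneOn_LoS h (h.trans h2) h2)
  · exact (min_le_right _ _).trans (S.antitoneOn_NLoS h (h.trans h2) h2)

lemma noise_le_load (hL : 0 < S.L) (ω : Realization) :
    ENNReal.ofReal (S.PN / (S.P * S.maxLoss)) ≤ S.load ω := by
  have := maxLoss_pos hL
  rw [ENNReal.ofReal_div_of_pos (mul_pos S.P_pos this)]
  refine ENNReal.div_le_div le_add_self (ENNReal.ofReal_le_ofReal ?_)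
  exact mul_le_mul_of_nonneg_left (loss_le_maxLoss _ _) S.P_pos.le

/-- Noise and all interferers outside `F` are dropped; each remaining ratio of path losses is at
least `nearLoss / maxLoss`. The bound does not depend on which station serves. -/
lemma near_le_load (hL : 0 < S.L) (ω : Realization) (F : Finset ℕ) (hF : S.servingIndex ω ∉ F)
    (hFb : ∀ i ∈ F, ω.1 i ∈ Metric.closedBall (0 : Plane) 1) :
    ∑ i ∈ F, ENNReal.ofReal (S.nearLoss / S.maxLoss) * ENNReal.ofReal (ω.2.2 i) ≤ S.load ω := by
  have hM := maxLoss_pos hL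
  have hn := S.nearLoss_pos
  have hP := S.P_pos
  have ho := loss_pos hL ω (S.servingIndex ω)
  have hle : ∑ i ∈ F, ENNReal.ofReal (S.P * S.loss ω i * ω.2.2 i) ≤ S.interference ω := by
    rw [interference_eq_tsum]
    refine le_trans (Finset.sum_le_sum fun i hi => ?_) (ENNReal.sum_le_tsum F)
    rw [if_pos (show i ≠ S.servingIndex ω from fun h => hF (h ▸ hi))]
  refine le_trans ?_ (ENNReal.div_le_div_right (hle.trans le_self_add) _)
  rw [ENNReal.div_eq_inv_mul, Finset.mul_sum]
  refine Finset.sum_le_sum fun i hi => ?_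
  have hi' := loss_pos hL ω i
  rw [ENNReal.ofReal_mul (q := ω.2.2 i) (by positivity), ← mul_assoc, ← ENNReal.div_eq_inv_mul,
    ← ENNReal.ofReal_div_of_pos (by positivity)]
  gcongr ENNReal.ofReal ?_ * _
  rw [mul_div_mul_left _ _ hP.ne']
  exact div_le_div₀ hi'.le (nearLoss_le_loss (hFb i hi)) ho (loss_le_maxLoss _ _)

/-! ### The coverage probability as a Laplace transform -/

lemma lt_SINR_iff (hL : 0 < S.L) {x : ℝ} (hx : 0 < x) (ω : Realization) :
    x < S.SINR ω ↔
      ENNReal.ofReal x * S.load ω < ENNReal.ofReal (ω.2.2 (S.servingIndex ω)) := by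
  have ho := mul_pos S.P_pos (loss_pos hL ω (S.servingIndex ω))
  have hN : ENNReal.ofReal S.PN ≠ 0 := by simpa using S.PN_pos
  have hD : S.interference ω + ENNReal.ofReal S.PN ≠ 0 := by simp [hN]
  rw [SINR, ← ENNReal.ofReal_lt_iff_lt_toReal hx.le (ENNReal.div_ne_top ENNReal.ofReal_ne_top hD),
    load, ENNReal.ofReal_mul ho.le, ← mul_div_assoc,
    ENNReal.div_lt_iff (Or.inl (by simpa using ho)) (Or.inl ENNReal.ofReal_ne_top),
    mul_comm (ENNReal.ofReal (ω.2.2 _))]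
  rcases eq_or_ne (S.interference ω + ENNReal.ofReal S.PN) ⊤ with h | h
  · simp [h, ENNReal.mul_top, hx]
  · exact ENNReal.lt_div_iff_mul_lt (Or.inl hD) (Or.inl h)

lemma measurableSet_lt_SINR (hL : 0 < S.L) {x : ℝ} (hx : 0 < x) :
    MeasurableSet {ω | x < S.SINR ω} := by
  simp_rw [lt_SINR_iff hL hx]
  have h1 := S.measurable_load
  have h : Measurable fun p : ℕ × Realization => p.2.2.2 p.1 :=
    measurable_from_prod_countable_right fun i =>
      (measurable_pi_apply i).comp (measurable_snd.comp measurable_snd)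
  have h2 : Measurable fun ω : Realization => ω.2.2 (S.servingIndex ω) :=
    h.comp (S.measurable_servingIndex.prodMk measurable_id)
  exact measurableSet_lt (by fun_prop) (by fun_prop)

lemma gain_lt_SINR (hL : 0 < S.L) {x : ℝ} (hx : 0 < x) (b : ℕ → Plane) (u : ℕ → unitInterval) :
    Measure.infinitePi (fun _ : ℕ => expMeasure 1) {g | x < S.SINR (b, u, g)} =
      ∫⁻ g, expKernel x (S.load (b, u, g)) ∂Measure.infinitePi (fun _ : ℕ => expMeasure 1) := by
  simp_rw [lt_SINR_iff hL hx]
  -- `servingIndex` and `loss` ignore the gains, so evaluating them at gains `0` is definitionally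
  -- harmless and exhibits the load as a function of the gains other than the serving one.
  exact infinitePi_exp_lt hx (S.servingIndex (b, u, 0))
    (T := fun y => ((∑' i : {i : ℕ // i ≠ S.servingIndex (b, u, 0)},
      ENNReal.ofReal (S.P * S.loss (b, u, 0) i * y i)) + ENNReal.ofReal S.PN) /
        ENNReal.ofReal (S.P * S.loss (b, u, 0) (S.servingIndex (b, u, 0))))
    (((Measurable.tsum fun i => by fun_prop).add_const _).div_const _)

instance : IsProbabilityMeasure (Measure.infinitePi fun _ : ℕ => expMeasure 1) := by
  have := isProbabilityMeasure_expMeasure one_pos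
  infer_instance

instance (ν : Measure (ℕ → Plane)) [IsProbabilityMeasure ν] :
    IsProbabilityMeasure (networkLaw ν) := by
  unfold networkLaw
  infer_instance

lemma lintegral_networkLaw (ν : Measure (ℕ → Plane)) [IsProbabilityMeasure ν]
    {f : Realization → ENNReal} (hf : Measurable f) :
    ∫⁻ ω, f ω ∂networkLaw ν =
      ∫⁻ b, ∫⁻ u, ∫⁻ g, f (b, u, g) ∂Measure.infinitePi (fun _ : ℕ => expMeasure 1)
        ∂Measure.infinitePi (fun _ : ℕ => (volume : Measure unitInterval)) ∂ν := by
  rw [networkLaw, lintegral_prod _ hf.aemeasurable]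
  refine lintegral_congr fun b => ?_
  exact lintegral_prod _ (hf.comp measurable_prodMk_left).aemeasurable

lemma networkLaw_lt_SINR (hL : 0 < S.L) {x : ℝ} (hx : 0 < x) (ν : Measure (ℕ → Plane))
    [IsProbabilityMeasure ν] :
    networkLaw ν {ω | x < S.SINR ω} = ∫⁻ ω, expKernel x (S.load ω) ∂networkLaw ν := by
  have hs := measurableSet_lt_SINR hL hx
  rw [lintegral_networkLaw ν (S.measurable_expKernel_load x),
    ← lintegral_indicator_one hs, lintegral_networkLaw ν (measurable_one.indicator hs)]
  refine lintegral_congr fun b => lintegral_congr fun u => ?_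
  have hs' : MeasurableSet {g | x < S.SINR (b, u, g)} :=
    ((measurable_prodMk_left (x := b)).comp (measurable_prodMk_left (x := u))) hs
  rw [← gain_lt_SINR hL hx b u, ← lintegral_indicator_one hs']
  rfl

/-! ### Exponential decay of the coverage probability in the density -/

/-- The serving station may be one of the `k` points and does not interfere with itself, hence the
loss of one factor `q`. Allowing `k` below the actual count also covers infinite counts. -/
lemma lintegral_gain_le (hL : 0 < S.L) {s q : ℝ} (hs : 0 < s) (hq0 : 0 < q) (hq1 : q < 1)
    (hq : ∫⁻ h, expKernel s (ENNReal.ofReal (S.nearLoss / S.maxLoss) * ENNReal.ofReal h)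
      ∂expMeasure 1 ≤ ENNReal.ofReal q)
    (b : ℕ → Plane) (u : ℕ → unitInterval) (k : ℕ)
    (hk : k ≤ pointCount b (Metric.closedBall 0 1)) :
    ∫⁻ g, expKernel s (S.load (b, u, g)) ∂Measure.infinitePi (fun _ : ℕ => expMeasure 1) ≤
      ENNReal.ofReal (q ^ k / q) := by
  obtain ⟨t, ht, htk⟩ := Set.exists_subset_encard_eq hk
  have htf : t.Finite := Set.finite_of_encard_eq_coe htk
  set F := htf.toFinset with hF
  have hFk : F.card = k := by
    have := htf.encard_eq_coe_toFinset_card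
    rw [htk] at this
    exact_mod_cast this.symm
  set o := S.servingIndex (b, u, 0) with ho
  calc _ ≤ ∫⁻ g, expKernel s (∑ i ∈ F.erase o,
        ENNReal.ofReal (S.nearLoss / S.maxLoss) * ENNReal.ofReal (g i))
          ∂Measure.infinitePi (fun _ : ℕ => expMeasure 1) := by
        refine lintegral_mono fun g => expKernel_anti hs.le ?_
        refine near_le_load hL (b, u, g) (F.erase o) (Finset.notMem_erase _ _) fun i hi => ?_
        exact ht (htf.mem_toFinset.1 (Finset.mem_of_mem_erase hi))
    _ ≤ ENNReal.ofReal q ^ (F.erase o).card := by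
        rw [lintegral_expKernel_sum]
        gcongr
    _ = ENNReal.ofReal (q ^ (F.erase o).card) := (ENNReal.ofReal_pow hq0.le _).symm
    _ ≤ ENNReal.ofReal (q ^ k / q) := by
        refine ENNReal.ofReal_le_ofReal ?_
        rw [le_div_iff₀ hq0, ← pow_succ]
        refine pow_le_pow_of_le_one hq0.le hq1.le ?_
        have := Finset.pred_card_le_card_erase (s := F) (a := o)
        omega

end NetworkModel

/-- The count is the sum of the indicators of `A` at the listed points, a countable sum of
measurable functions. -/
lemma measurableSet_pointCount_eq {A : Set Plane} (hA : MeasurableSet A) (k : ℕ∞) :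
    MeasurableSet {b : ℕ → Plane | pointCount b A = k} := by
  have h : ∀ b : ℕ → Plane, ((pointCount b A : ℕ∞) : ENNReal) =
      ∑' i, A.indicator (1 : Plane → ENNReal) (b i) := fun b => by
    rw [pointCount, ← Measure.count_apply (MeasurableSet.of_discrete), ← lintegral_indicator_one
      MeasurableSet.of_discrete, lintegral_count]
    rfl
  have hm : Measurable fun b : ℕ → Plane => ∑' i, A.indicator (1 : Plane → ENNReal) (b i) :=
    Measurable.tsum fun i => (measurable_one.indicator hA).comp (measurable_pi_apply i)
  have : {b : ℕ → Plane | pointCount b A = k} =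
      (fun b : ℕ → Plane => ∑' i, A.indicator (1 : Plane → ENNReal) (b i)) ⁻¹' {(k : ENNReal)} := by
    ext b
    simp [← h]
  rw [this]
  exact hm (measurableSet_singleton _)

/-- A bound by a multiple of the probability generating function of the number of points. -/
lemma IsHPPP.lintegral_le {lam : ℝ} (hlam : 0 ≤ lam) {ν : Measure (ℕ → Plane)} (hν : IsHPPP lam ν)
    {A : Set Plane} (hA : MeasurableSet A) (hAb : Bornology.IsBounded A) {C q : ℝ} (hC : 0 ≤ C)
    (hq : 0 ≤ q) {f : (ℕ → Plane) → ENNReal} (htop : ∀ b, pointCount b A = ⊤ → f b = 0)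
    (hf : ∀ b (k : ℕ), pointCount b A = k → f b ≤ ENNReal.ofReal (C * q ^ k)) :
    ∫⁻ b, f b ∂ν ≤ ENNReal.ofReal (C * Real.exp (-((1 - q) * volume.real A * lam))) := by
  set m := lam * volume.real A with hm
  have hm0 : 0 ≤ m := by positivity
  have hle : ∀ b, f b ≤ ∑' k : ℕ, {b : ℕ → Plane | pointCount b A = k}.indicator
      (fun _ => ENNReal.ofReal (C * q ^ k)) b := fun b => by
    rcases h : pointCount b A with _ | k
    · rw [htop b h]
      exact zero_le
    · refine (hf b k h).trans (le_trans ?_ (ENNReal.le_tsum k))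
      rw [Set.indicator_of_mem (show b ∈ {b : ℕ → Plane | pointCount b A = k} from h)]
  -- Poisson generating function: the sum of q^k e^(-m) m^k / k! is e^(-(1-q)m).
  have hsum : HasSum (fun k : ℕ => C * q ^ k * (Real.exp (-m) * m ^ k / k.factorial))
      (C * Real.exp (-((1 - q) * volume.real A * lam))) := by
    have h := (NormedSpace.expSeries_div_hasSum_exp (q * m)).mul_left (C * Real.exp (-m))
    rw [← Real.exp_eq_exp_ℝ] at h
    rw [mul_assoc, ← Real.exp_add, show -m + q * m = -((1 - q) * volume.real A * lam) by
      rw [hm]; ring] at h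
    refine h.congr_fun fun k => ?_
    rw [mul_pow]
    ring
  calc ∫⁻ b, f b ∂ν ≤ ∫⁻ b, ∑' k : ℕ, {b : ℕ → Plane | pointCount b A = k}.indicator
        (fun _ => ENNReal.ofReal (C * q ^ k)) b ∂ν := lintegral_mono hle
    _ = ∑' k : ℕ, ENNReal.ofReal (C * q ^ k * (Real.exp (-m) * m ^ k / k.factorial)) := by
        rw [lintegral_tsum fun k => (measurable_const.indicator
          (measurableSet_pointCount_eq hA _)).aemeasurable]
        refine tsum_congr fun k => ?_
        rw [lintegral_indicator_const (measurableSet_pointCount_eq hA _),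
          hν.count_poisson A hA hAb k, ← ENNReal.ofReal_mul (by positivity)]
    _ = _ := by
        rw [← ENNReal.ofReal_tsum_of_nonneg (fun k => by positivity) hsum.summable, hsum.tsum_eq]

namespace NetworkModel

variable {S : NetworkModel}

lemma exists_lintegral_expKernel_load_le (hL : 0 < S.L) {s : ℝ} (hs : 0 < s) :
    ∃ C κ : ℝ, 0 < C ∧ 0 < κ ∧ ∀ (lam : ℝ) (ν : Measure (ℕ → Plane)), 0 < lam → IsHPPP lam ν →
      ∫⁻ ω, expKernel s (S.load ω) ∂networkLaw ν ≤ ENNReal.ofReal (C * Real.exp (-(κ * lam))) := by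
  have hlt := lintegral_expKernel_lt_one hs (c := ENNReal.ofReal (S.nearLoss / S.maxLoss))
    (by simpa using div_pos S.nearLoss_pos (maxLoss_pos hL))
  obtain ⟨q, hq0, hq, hq1⟩ : ∃ q : ℝ, 0 < q ∧
      ∫⁻ h, expKernel s (ENNReal.ofReal (S.nearLoss / S.maxLoss) * ENNReal.ofReal h)
        ∂expMeasure 1 ≤ ENNReal.ofReal q ∧ q < 1 := by
    -- The maximum with 1/2 keeps `q` positive, since `q` is divided by below.
    refine ⟨max (∫⁻ h, expKernel s (ENNReal.ofReal (S.nearLoss / S.maxLoss) * ENNReal.ofReal h)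
        ∂expMeasure 1).toReal (1 / 2), by positivity, ?_, ?_⟩
    · refine (ENNReal.ofReal_toReal (ne_top_of_lt hlt)).symm.trans_le ?_
      exact ENNReal.ofReal_le_ofReal (le_max_left _ _)
    · refine max_lt ?_ (by norm_num)
      rw [← ENNReal.toReal_one]
      exact (ENNReal.toReal_lt_toReal (ne_top_of_lt hlt) ENNReal.one_ne_top).2 hlt
  have hvol : 0 < volume.real (Metric.closedBall (0 : Plane) 1) :=
    ENNReal.toReal_pos (Metric.measure_closedBall_pos _ _ one_pos).ne' measure_closedBall_lt_top.ne
  refine ⟨q⁻¹, (1 - q) * volume.real (Metric.closedBall (0 : Plane) 1), by positivity,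
    mul_pos (by linarith) hvol, fun lam ν hlam hν => ?_⟩
  have := hν.isProbabilityMeasure
  rw [lintegral_networkLaw ν (S.measurable_expKernel_load s)]
  have key : ∀ b (k : ℕ), k ≤ pointCount b (Metric.closedBall 0 1) →
      ∫⁻ u, ∫⁻ g, expKernel s (S.load (b, u, g)) ∂Measure.infinitePi (fun _ : ℕ => expMeasure 1)
        ∂Measure.infinitePi (fun _ : ℕ => (volume : Measure unitInterval)) ≤
      ENNReal.ofReal (q⁻¹ * q ^ k) := fun b k hk => by
    refine (lintegral_mono fun u => lintegral_gain_le hL hs hq0 hq1 hq b u k hk).trans ?_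
    simp [div_eq_inv_mul]
  refine hν.lintegral_le hlam.le Metric.isClosed_closedBall.measurableSet Metric.isBounded_closedBall
    (by positivity) hq0.le (fun b hb => ?_) fun b k hk => key b k hk.ge
  -- With infinitely many points in the disc the bound holds for every `k`, so the integral
  -- vanishes.
  have ht : Tendsto (fun k : ℕ => ENNReal.ofReal (q⁻¹ * q ^ k)) atTop (𝓝 0) := by
    rw [← ENNReal.ofReal_zero]
    refine ENNReal.tendsto_ofReal ?_
    simpa using (tendsto_pow_atTop_nhds_zero_of_lt_one hq0.le hq1).const_mul q⁻¹
  exact nonpos_iff_eq_zero.1 (ge_of_tendsto' ht fun k => key b k (hb ▸ le_top))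

end NetworkModel

/-! ### Laplace transforms of random variables bounded away from zero -/

section LaplaceTransform

variable {Ω : Type*} [MeasurableSpace Ω] {μ : Measure Ω} [IsFiniteMeasure μ] {Y : Ω → ℝ}

lemma integrable_exp_neg_mul (hY : Measurable Y) (hY0 : ∀ᵐ ω ∂μ, 0 ≤ Y ω) {x : ℝ} (hx : 0 ≤ x) :
    Integrable (fun ω => Real.exp (-(x * Y ω))) μ := by
  refine Integrable.of_bound (by fun_prop) 1 ?_
  filter_upwards [hY0] with ω h
  rw [Real.norm_of_nonneg (Real.exp_nonneg _), Real.exp_le_one_iff]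
  have := mul_nonneg hx h
  linarith

/-- This is the moment generating function of `Y` at `-x`; as `Y ≥ 0`, the negative half-line lies
in the interior of its domain. -/
lemma hasDerivAt_integral_exp_neg_mul (hY : Measurable Y) (hY0 : ∀ᵐ ω ∂μ, 0 ≤ Y ω) {x : ℝ}
    (hx : 0 < x) :
    HasDerivAt (fun x => ∫ ω, Real.exp (-(x * Y ω)) ∂μ)
      (-∫ ω, Y ω * Real.exp (-(x * Y ω)) ∂μ) x := by
  have hsub : Set.Iio 0 ⊆ integrableExpSet Y μ := fun t ht => by
    simpa [integrableExpSet] using integrable_exp_neg_mul hY hY0 (neg_nonneg.2 (le_of_lt ht))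
  have hmem : -x ∈ interior (integrableExpSet Y μ) :=
    interior_maximal hsub isOpen_Iio (by simpa using hx)
  have h := (hasDerivAt_mgf hmem).comp x (hasDerivAt_neg x)
  simpa [mgf, Function.comp_def] using h

/-- The density of a distribution with Laplace tail decays exponentially. -/
lemma integral_mul_exp_neg_mul_le (hY : Measurable Y) {c : ℝ} (hc : 0 ≤ c)
    (hcY : ∀ᵐ ω ∂μ, c ≤ Y ω) {γ x : ℝ} (hγ : 0 < γ) (hx : γ ≤ x) :
    ∫ ω, Y ω * Real.exp (-(x * Y ω)) ∂μ ≤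
      2 / γ * Real.exp (-(c / 4 * x)) * ∫ ω, Real.exp (-(γ / 4 * Y ω)) ∂μ := by
  have hY0 : ∀ᵐ ω ∂μ, 0 ≤ Y ω := hcY.mono fun ω h => hc.trans h
  rw [← integral_const_mul]
  refine integral_mono_of_nonneg ?_ ((integrable_exp_neg_mul hY hY0 (by positivity)).const_mul _) ?_
  · filter_upwards [hY0] with ω h using mul_nonneg h (Real.exp_nonneg _)
  · filter_upwards [hcY] with ω h
    have h0 : 0 ≤ Y ω := hc.trans h
    have h1 : Y ω ≤ 2 / γ * Real.exp (γ / 2 * Y ω) := by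
      rw [div_mul_eq_mul_div, le_div_iff₀ hγ]
      have := Real.add_one_le_exp (γ / 2 * Y ω)
      linarith
    -- Split x·Y as 1/2 + 1/4 + 1/4: by γ ≤ x the first two shares pay for γY/2 and γY/4, and by c ≤
    -- Y the last pays for cx/4.
    have h2 : γ / 2 * Y ω + -(x * Y ω) ≤ -(c / 4 * x) + -(γ / 4 * Y ω) := by
      have e1 : γ * Y ω ≤ x * Y ω := mul_le_mul_of_nonneg_right hx h0
      have e2 : c * x ≤ Y ω * x := mul_le_mul_of_nonneg_right h (hγ.le.trans hx)
      nlinarith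
    calc Y ω * Real.exp (-(x * Y ω))
        ≤ 2 / γ * Real.exp (γ / 2 * Y ω) * Real.exp (-(x * Y ω)) := by gcongr
      _ = 2 / γ * Real.exp (γ / 2 * Y ω + -(x * Y ω)) := by rw [Real.exp_add, mul_assoc]
      _ ≤ 2 / γ * Real.exp (-(c / 4 * x) + -(γ / 4 * Y ω)) := by gcongr
      _ = _ := by rw [Real.exp_add, mul_assoc]

end LaplaceTransform

lemma integrableOn_logb_mul_exp_neg_mul {c γ : ℝ} (hc : 0 < c) (hγ : 0 ≤ γ) :
    IntegrableOn (fun x => Real.logb 2 (1 + x) * Real.exp (-(c * x))) (Set.Ioi γ) := by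
  have h1 : IntegrableOn (fun x : ℝ => x ^ (1 : ℝ) * Real.exp (-c * x ^ (1 : ℝ))) (Set.Ioi 0) :=
    integrableOn_rpow_mul_exp_neg_mul_rpow (by norm_num) one_pos hc
  simp only [Real.rpow_one] at h1
  refine Integrable.mono' ((h1.mono_set (Set.Ioi_subset_Ioi hγ)).const_mul (Real.log 2)⁻¹)
    (by unfold Real.logb; fun_prop) ?_
  filter_upwards [ae_restrict_mem measurableSet_Ioi] with x (hx : γ < x)
  have hx0 : 0 < x := hγ.trans_lt hx
  have hl : Real.log (1 + x) ≤ x := by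
    have := Real.log_le_sub_one_of_pos (show 0 < 1 + x by linarith)
    linarith
  have hl0 : 0 ≤ Real.log (1 + x) := Real.log_nonneg (by linarith)
  have h2 : 0 < Real.log 2 := Real.log_pos (by norm_num)
  rw [Real.norm_of_nonneg (by unfold Real.logb; positivity), Real.logb, div_eq_inv_mul, mul_assoc,
    neg_mul]
  gcongr

namespace NetworkModel

variable {S : NetworkModel}

/-! ### The SINR distribution -/

/-- The law of the network restricted to the realizations with finite interference. -/
noncomputable def finiteLaw (S : NetworkModel) (ν : Measure (ℕ → Plane)) : Measure Realization :=
  (networkLaw ν).restrict {ω | S.load ω ≠ ⊤}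

instance (ν : Measure (ℕ → Plane)) [IsProbabilityMeasure ν] : IsFiniteMeasure (S.finiteLaw ν) := by
  unfold finiteLaw
  infer_instance

lemma noise_le_toReal_load (hL : 0 < S.L) (ν : Measure (ℕ → Plane)) :
    ∀ᵐ ω ∂S.finiteLaw ν, S.PN / (S.P * S.maxLoss) ≤ (S.load ω).toReal := by
  have hm : MeasurableSet {ω | S.load ω ≠ ⊤} :=
    (S.measurable_load (measurableSet_singleton ⊤)).compl
  filter_upwards [ae_restrict_mem hm] with ω h
  exact (ENNReal.ofReal_le_iff_le_toReal h).1 (noise_le_load hL ω)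

/-- Restricting to finite load is essential: the kernel vanishes at `⊤`, whereas `toReal ⊤ = 0`
would contribute exp(0) = 1. -/
lemma coverageProb_eq_integral (hL : 0 < S.L) (ν : Measure (ℕ → Plane)) [IsProbabilityMeasure ν]
    {x : ℝ} (hx : 0 < x) :
    S.coverageProb ν x = ∫ ω, Real.exp (-(x * (S.load ω).toReal)) ∂S.finiteLaw ν := by
  have hm : MeasurableSet {ω | S.load ω ≠ ⊤} :=
    (S.measurable_load (measurableSet_singleton ⊤)).compl
  have hl : Measurable fun ω => Real.exp (-(x * (S.load ω).toReal)) :=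
    (S.measurable_load.ennreal_toReal.const_mul x).neg.exp
  rw [integral_eq_lintegral_of_nonneg_ae (ae_of_all _ fun ω => Real.exp_nonneg _)
    hl.aestronglyMeasurable, coverageProb, Measure.real, networkLaw_lt_SINR hL hx, finiteLaw,
    ← lintegral_indicator hm]
  congr 1
  refine lintegral_congr fun ω => ?_
  by_cases h : S.load ω = ⊤
  · simp [h]
  · simp [h, expKernel]

lemma maxNoise_pos (hL : 0 < S.L) : 0 < S.PN / (S.P * S.maxLoss) :=
  div_pos S.PN_pos (mul_pos S.P_pos (maxLoss_pos hL))

lemma toReal_load_nonneg (ν : Measure (ℕ → Plane)) :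
    ∀ᵐ ω ∂S.finiteLaw ν, 0 ≤ (S.load ω).toReal := ae_of_all _ fun _ => ENNReal.toReal_nonneg

lemma hasDerivAt_coverageProb (hL : 0 < S.L) (ν : Measure (ℕ → Plane)) [IsProbabilityMeasure ν]
    {x : ℝ} (hx : 0 < x) :
    HasDerivAt (S.coverageProb ν)
      (-∫ ω, (S.load ω).toReal * Real.exp (-(x * (S.load ω).toReal)) ∂S.finiteLaw ν) x := by
  refine (hasDerivAt_integral_exp_neg_mul S.measurable_load.ennreal_toReal
    (toReal_load_nonneg ν) hx).congr_of_eventuallyEq ?_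
  filter_upwards [Ioi_mem_nhds hx] with y hy using coverageProb_eq_integral hL ν hy

lemma sinrDensity_eq_integral (hL : 0 < S.L) (ν : Measure (ℕ → Plane)) [IsProbabilityMeasure ν]
    {x : ℝ} (hx : 0 < x) :
    S.sinrDensity ν x =
      ∫ ω, (S.load ω).toReal * Real.exp (-(x * (S.load ω).toReal)) ∂S.finiteLaw ν := by
  exact ((hasDerivAt_coverageProb hL ν hx).const_sub 1).deriv.trans (neg_neg _)

lemma sinrDensity_nonneg (hL : 0 < S.L) (ν : Measure (ℕ → Plane)) [IsProbabilityMeasure ν]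
    {x : ℝ} (hx : 0 < x) : 0 ≤ S.sinrDensity ν x := by
  rw [sinrDensity_eq_integral hL ν hx]
  exact integral_nonneg fun ω => mul_nonneg ENNReal.toReal_nonneg (Real.exp_nonneg _)

lemma sinrDensity_le (hL : 0 < S.L) (ν : Measure (ℕ → Plane)) [IsProbabilityMeasure ν]
    {γ x : ℝ} (hγ : 0 < γ) (hx : γ ≤ x) :
    S.sinrDensity ν x ≤ 2 / γ * Real.exp (-(S.PN / (S.P * S.maxLoss) / 4 * x)) *
      S.coverageProb ν (γ / 4) := by
  rw [sinrDensity_eq_integral hL ν (hγ.trans_le hx), coverageProb_eq_integral hL ν (by positivity)]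
  exact integral_mul_exp_neg_mul_le S.measurable_load.ennreal_toReal (maxNoise_pos hL).le
    (noise_le_toReal_load hL ν) hγ hx

lemma logb_mul_sinrDensity_bounds (hL : 0 < S.L) (ν : Measure (ℕ → Plane)) [IsProbabilityMeasure ν]
    {γ x : ℝ} (hγ : 0 < γ) (hx : γ ≤ x) :
    0 ≤ Real.logb 2 (1 + x) * S.sinrDensity ν x ∧
    Real.logb 2 (1 + x) * S.sinrDensity ν x ≤ S.coverageProb ν (γ / 4) * (2 / γ) *
      (Real.logb 2 (1 + x) * Real.exp (-(S.PN / (S.P * S.maxLoss) / 4 * x))) := by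
  have hlog : 0 ≤ Real.logb 2 (1 + x) := Real.logb_nonneg (by norm_num) (by linarith)
  refine ⟨mul_nonneg hlog (sinrDensity_nonneg hL ν (hγ.trans_le hx)), ?_⟩
  refine (mul_le_mul_of_nonneg_left (sinrDensity_le hL ν hγ hx) hlog).trans_eq ?_
  ring

lemma integrableOn_logb_mul_sinrDensity (hL : 0 < S.L) (ν : Measure (ℕ → Plane))
    [IsProbabilityMeasure ν] {γ : ℝ} (hγ : 0 < γ) :
    IntegrableOn (fun x => Real.logb 2 (1 + x) * S.sinrDensity ν x) (Set.Ioi γ) := by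
  have hd : Measurable (S.sinrDensity ν) := measurable_deriv _
  refine Integrable.mono' ((integrableOn_logb_mul_exp_neg_mul
    (div_pos (maxNoise_pos hL) four_pos) hγ.le).const_mul (S.coverageProb ν (γ / 4) * (2 / γ)))
    (by unfold Real.logb; fun_prop) ?_
  filter_upwards [ae_restrict_mem measurableSet_Ioi] with x (hx : γ < x)
  have h := logb_mul_sinrDensity_bounds hL ν hγ hx.le
  rw [Real.norm_of_nonneg h.1]
  exact h.2

lemma ASE_nonneg (hL : 0 < S.L) {lam : ℝ} (hlam : 0 ≤ lam) (ν : Measure (ℕ → Plane))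
    [IsProbabilityMeasure ν] {γ : ℝ} (hγ : 0 < γ) : 0 ≤ S.ASE lam ν γ :=
  mul_nonneg hlam (setIntegral_nonneg measurableSet_Ioi fun _ hx =>
    (logb_mul_sinrDensity_bounds hL ν hγ (le_of_lt hx)).1)

lemma ASE_le (hL : 0 < S.L) {lam : ℝ} (hlam : 0 ≤ lam) (ν : Measure (ℕ → Plane))
    [IsProbabilityMeasure ν] {γ : ℝ} (hγ : 0 < γ) :
    S.ASE lam ν γ ≤ lam * S.coverageProb ν (γ / 4) * (2 / γ * ∫ x in Set.Ioi γ,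
      Real.logb 2 (1 + x) * Real.exp (-(S.PN / (S.P * S.maxLoss) / 4 * x))) := by
  rw [ASE, mul_assoc lam, ← mul_assoc (S.coverageProb ν (γ / 4)),
    ← integral_const_mul (S.coverageProb ν (γ / 4) * (2 / γ))]
  refine mul_le_mul_of_nonneg_left ?_ hlam
  exact setIntegral_mono_on (integrableOn_logb_mul_sinrDensity hL ν hγ)
    ((integrableOn_logb_mul_exp_neg_mul (div_pos (maxNoise_pos hL) four_pos) hγ.le).const_mul _)
    measurableSet_Ioi fun x hx => (logb_mul_sinrDensity_bounds hL ν hγ (le_of_lt hx)).2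

/-! ### Limits as the density tends to infinity -/

lemma exists_coverageProb_le (hL : 0 < S.L) {x : ℝ} (hx : 0 < x) :
    ∃ C κ : ℝ, 0 < C ∧ 0 < κ ∧ ∀ (lam : ℝ) (ν : Measure (ℕ → Plane)), 0 < lam → IsHPPP lam ν →
      S.coverageProb ν x ≤ C * Real.exp (-(κ * lam)) := by
  obtain ⟨C, κ, hC, hκ, h⟩ := exists_lintegral_expKernel_load_le hL hx
  refine ⟨C, κ, hC, hκ, fun lam ν hlam hν => ?_⟩
  have := hν.isProbabilityMeasure
  refine ENNReal.toReal_le_of_le_ofReal (by positivity) ?_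
  rw [networkLaw_lt_SINR hL hx]
  exact h lam ν hlam hν

lemma tendsto_mul_coverageProb (hL : 0 < S.L) {ν : ℝ → Measure (ℕ → Plane)}
    (hν : ∀ lam : ℝ, 0 < lam → IsHPPP lam (ν lam)) {x : ℝ} (hx : 0 < x) :
    Tendsto (fun lam => lam * S.coverageProb (ν lam) x) atTop (𝓝 0) := by
  obtain ⟨C, κ, hC, hκ, h⟩ := exists_coverageProb_le hL hx
  have hlim : Tendsto (fun lam : ℝ => C * (lam * Real.exp (-(κ * lam)))) atTop (𝓝 0) := by
    have := (tendsto_rpow_mul_exp_neg_mul_atTop_nhds_zero 1 κ hκ).const_mul C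
    simpa using this
  refine tendsto_of_tendsto_of_tendsto_of_le_of_le' tendsto_const_nhds hlim ?_ ?_
  · filter_upwards [eventually_gt_atTop 0] with lam hlam
    exact mul_nonneg hlam.le measureReal_nonneg
  · filter_upwards [eventually_gt_atTop 0] with lam hlam
    refine (mul_le_mul_of_nonneg_left (h lam _ hlam (hν lam hlam)) hlam.le).trans_eq ?_
    ring

lemma tendsto_coverageProb (hL : 0 < S.L) {ν : ℝ → Measure (ℕ → Plane)}
    (hν : ∀ lam : ℝ, 0 < lam → IsHPPP lam (ν lam)) {x : ℝ} (hx : 0 < x) :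
    Tendsto (fun lam => S.coverageProb (ν lam) x) atTop (𝓝 0) := by
  refine tendsto_of_tendsto_of_tendsto_of_le_of_le' tendsto_const_nhds
    (tendsto_mul_coverageProb hL hν hx) (Eventually.of_forall fun _ => measureReal_nonneg) ?_
  -- For λ ≥ 1 the coverage is at most λ times itself, which already tends to 0.
  filter_upwards [eventually_ge_atTop 1] with lam hlam
  exact le_mul_of_one_le_left measureReal_nonneg hlam

lemma tendsto_ASE (hL : 0 < S.L) {ν : ℝ → Measure (ℕ → Plane)}
    (hν : ∀ lam : ℝ, 0 < lam → IsHPPP lam (ν lam)) {γ : ℝ} (hγ : 0 < γ) :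
    Tendsto (fun lam => S.ASE lam (ν lam) γ) atTop (𝓝 0) := by
  have hlim := (tendsto_mul_coverageProb hL hν (show 0 < γ / 4 by positivity)).mul_const
    (2 / γ * ∫ x in Set.Ioi γ,
      Real.logb 2 (1 + x) * Real.exp (-(S.PN / (S.P * S.maxLoss) / 4 * x)))
  rw [zero_mul] at hlim
  refine tendsto_of_tendsto_of_tendsto_of_le_of_le' tendsto_const_nhds hlim ?_ ?_
  · filter_upwards [eventually_gt_atTop 0] with lam hlam
    have := (hν lam hlam).isProbabilityMeasure
    exact ASE_nonneg hL hlam.le (ν lam) hγ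
  · filter_upwards [eventually_gt_atTop 0] with lam hlam
    have := (hν lam hlam).isProbabilityMeasure
    exact ASE_le hL hlam.le (ν lam) hγ

end NetworkModel

/-- The ASE crash theorem. For every density `lam > 0`, `ν lam` is the law of the positions of the
base stations. The second and third conjuncts say that the area spectral efficiency is
well defined. -/
theorem theorem2 (S : NetworkModel) (hL : 0 < S.L)
    (ν : ℝ → Measure (ℕ → Plane)) (hν : ∀ lam : ℝ, 0 < lam → IsHPPP lam (ν lam))
    (γ γ₀ : ℝ) (hγ : 0 < γ) (hγ₀ : 0 < γ₀) :
    Tendsto (fun lam => S.coverageProb (ν lam) γ) atTop (𝓝 0) ∧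
    (∀ lam : ℝ, 0 < lam → ∀ x : ℝ, 0 < x →
      DifferentiableAt ℝ (S.coverageProb (ν lam)) x) ∧
    (∀ lam : ℝ, 0 < lam →
      IntegrableOn (fun x => Real.logb 2 (1 + x) * S.sinrDensity (ν lam) x) (Set.Ioi γ₀)) ∧
    Tendsto (fun lam => S.ASE lam (ν lam) γ₀) atTop (𝓝 0) := by
  refine ⟨NetworkModel.tendsto_coverageProb hL hν hγ, fun lam hlam x hx => ?_, fun lam hlam => ?_,
    NetworkModel.tendsto_ASE hL hν hγ₀⟩
  · have := (hν lam hlam).isProbabilityMeasure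
    exact (NetworkModel.hasDerivAt_coverageProb hL (ν lam) hx).differentiableAt
  · have := (hν lam hlam).isProbabilityMeasure
    exact NetworkModel.integrableOn_logb_mul_sinrDensity hL (ν lam) hγ₀
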